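/- **Corollary.** For all constants $\Delta$ and $c$ there are a constant $C$ and a deterministic algorithm in the LOCAL model with the following property. Let $G=(V,E)$ be a finite connected graph on $n$ nodes with maximum degree at most $\Delta$ and diameter greater than $3$, whose nodes carry distinct identifiers from $\{0,1,\dots,n^c\}$, and let $\alpha,\beta\subseteq V$ be two maximal independent sets of $G$. When each node initially knows $n$, its own identifier, and whether it belongs to $\alpha$ and whether it belongs to $\beta$, the algorithm terminates after at most $C\log^* n$ communication rounds (so in $O(\log^* n)$ rounds), and each node $v$ outputs, for every $0\le i\le 28$, whether $v\in S_i$, where $(S_0,\dots,S_{28})$ is an $(\alpha,\beta,P)$-reconfiguration schedule of length $28$ for the property $P$ of being a $(2,4)$-ruling set; that is: 1. $S_0=\alpha$ and $S_{28}=\beta$; 2. for every $0<i<28$, the set $S_i$ is a $(2,4)$-ruling set of $G$: any two distinct nodes of $S_i$ are at distance at least $2$ (so $S_i$ is independent), and every node not in $S_i$ is within distance at most $4$ of a node of $S_i$; 3. for every $0<i\le 28$, the symmetric difference $S_i\oplus S_{i-1}$ is an independent set of $G$. Here, in the LOCAL model all nodes run the same algorithm in synchronous rounds; in each round every node exchanges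 messages of unbounded size with its neighbours and then performs an arbitrary local computation. $\log^* n$ is the number of times that $\log_2$ must be applied to $n$ until the result is at most $1$. -/

import Mathlib

/-- `U` is an `(x, y)`-ruling set of `G`: any two distinct nodes of `U` are at distance at least
`x`, and every node outside `U` is within distance `y` of some node of `U`. -/
def IsRulingSet {V : Type*} (G : SimpleGraph V) (x y : ℕ) (U : Set V) : Prop :=
  (∀ u ∈ U, ∀ v ∈ U, u ≠ v → (x : ℕ∞) ≤ G.edist u v) ∧
    ∀ v, v ∉ U → ∃ u ∈ U, G.edist v u ≤ (y : ℕ∞)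

/-- `S = (S_0, …, S_ℓ)` is an `(α, β, P)`-reconfiguration schedule of length `ℓ` in `G`, where `P`
is a property of a graph with a distinguished set of nodes. -/
structure IsReconfigurationSchedule {V : Type*} (G : SimpleGraph V)
    (P : SimpleGraph V → Set V → Prop) (α β : Set V) (ℓ : ℕ) (S : Fin (ℓ + 1) → Set V) :
    Prop where
  start : S 0 = α
  finish : S (Fin.last ℓ) = β
  property : ∀ i : Fin (ℓ + 1), 0 < i → i < Fin.last ℓ → P G (S i)
  step : ∀ i : Fin ℓ, G.IsIndepSet (symmDiff (S i.succ) (S i.castSucc))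

/-- A deterministic algorithm in the LOCAL model. Every node runs the same algorithm; it starts
with the number `n` of nodes of the network, its own identifier and its own input. In each
synchronous round it sends a message of unbounded size to all of its neighbours, receives the
messages of its neighbours, and updates its state; local computation is unrestricted. On a network
with `n` nodes it runs for `rounds n` rounds, after which every node computes its output from its
state. (As nodes have distinct identifiers, which they may put into their messages, sending one and
the same message to all neighbours and receiving an unordered collection is no restriction.) -/
structure LocalAlgorithm (In Out : Type) where
  State : Type
  Msg : Type
  /-- the initial state, from `n`, the identifier and the input of the node -/
  init : ℕ → ℕ → In → State
  send : State → Msg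
  /-- the new state, from the old state and the messages received from the neighbours -/
  receive : State → Multiset Msg → State
  rounds : ℕ → ℕ
  output : State → Out

namespace LocalAlgorithm

variable {In Out : Type} {V : Type*} [Fintype V]

/-- The state of each node after `t` rounds on the network `G`, with identifiers `ident` and
inputs `input`. -/
def stateAfter (A : LocalAlgorithm In Out) (G : SimpleGraph V) [DecidableRel G.Adj]
    (ident : V → ℕ) (input : V → In) : ℕ → V → A.State
  | 0, v => A.init (Fintype.card V) (ident v) (input v)
  | t + 1, v => A.receive (stateAfter A G ident input t v)
      ((G.neighborFinset v).val.map fun u => A.send (stateAfter A G ident input t u))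

/-- The outputs of the nodes when the algorithm terminates. -/
def run (A : LocalAlgorithm In Out) (G : SimpleGraph V) [DecidableRel G.Adj]
    (ident : V → ℕ) (input : V → In) (v : V) : Out :=
  A.output (A.stateAfter G ident input (A.rounds (Fintype.card V)) v)

end LocalAlgorithm

open Classical in
/-- The input of MIS reconfiguration at a node: whether it is in `α`, and whether it is in `β`. -/
noncomputable def reconfigurationInput {V : Type*} (α β : Set V) (v : V) : Bool × Bool :=
  (decide (v ∈ α), decide (v ∈ β))

/-- The sequence of sets that the nodes describe when each node `v` outputs, for every
`0 ≤ i ≤ ℓ`, whether it belongs to the `i`-th set. -/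
def outputSets {V : Type*} {ℓ : ℕ} (out : V → Fin (ℓ + 1) → Bool) (i : Fin (ℓ + 1)) : Set V :=
  {v | out v i = true}

/-- The iterated logarithm `log* n`: the number of times that `log₂` has to be applied to `n`
until the result is at most `1`. -/
noncomputable def logStar (n : ℕ) : ℕ :=
  sInf {k : ℕ | (Real.logb 2)^[k] (n : ℝ) ≤ 1}

/-- The infimum that defines `log* n` is attained. -/
theorem logStar_spec (n : ℕ) : (Real.logb 2)^[logStar n] (n : ℝ) ≤ 1 := by
  have key : ∀ (m : ℕ) (x : ℝ), x ≤ (m : ℝ) + 1 → ∃ k : ℕ, (Real.logb 2)^[k] x ≤ 1 := by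
    intro m
    induction m with
    | zero => intro x hx; exact ⟨0, by simpa using hx⟩
    | succ m ih =>
      intro x hx
      by_cases h1 : x ≤ 1
      · exact ⟨0, h1⟩
      · have h0 : 0 < x := by linarith
        have hp : ((m : ℝ) + 2) ≤ (2 : ℝ) ^ (m + 1) := by
          have h := Nat.lt_two_pow_self (n := m + 1)
          have h' : m + 2 ≤ 2 ^ (m + 1) := by omega
          exact_mod_cast h'
        have hl : Real.logb 2 x ≤ (m : ℝ) + 1 := by
          rw [Real.logb_le_iff_le_rpow (by norm_num) h0]
          have : (2 : ℝ) ^ ((m : ℝ) + 1) = (2 : ℝ) ^ (m + 1) := by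
            rw [← Real.rpow_natCast]; push_cast; rfl
          rw [this]
          push_cast at hx
          linarith
        obtain ⟨k, hk⟩ := ih _ hl
        exact ⟨k + 1, by simpa [Function.iterate_succ_apply] using hk⟩
  exact Nat.sInf_mem (s := {k : ℕ | (Real.logb 2)^[k] (n : ℝ) ≤ 1}) (key n n (by linarith))

/-! ### Distances in connected graphs -/

namespace SimpleGraph

variable {V : Type*} {G : SimpleGraph V}

/-! The way from `α` to `β` leads through an independent set of permanent nodes that depends on
neither. Permanent sets `R 1 ⊆ … ⊆ R 5` are introduced one at a time: first the neighbours of `R (j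
+ 1)` leave `α`, then `R (j + 1)` enters. When `R 5` is in place the rest of `α` is dropped, and the
same route is run backwards for `β`. Consecutive sets are nested independent sets, so their
symmetric difference is independent; only domination at distance 4 needs an argument.

The delicate moment is the first clearing, when no permanent node is present yet. Hence `R 1`
consists of cores, nodes whose 2-ball is minimal under inclusion, at pairwise distance more than 6.
A node that loses its neighbour in `α` to a core `r` can then reach, within 3 steps, a node outside
the 2-ball of `r`, and a node of `α` next to that one survives (`dominates_clearing_of_isNet`). In
later clearings every new permanent node has an old one at distance 2, which takes over. Cores
2-dominate, so `R 1` 8-dominates, and each growth step lowers the radius by one, down to 4 for `R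
5`.

For the running time, iterated colour reduction turns the identifiers into a distance-6 colouring
with boundedly many colours in `O(log* n)` rounds. Given the colouring, greedy selection by colour
class finds every net in a constant number of rounds, and the rest is read off from a ball of
constant radius. -/

theorem Connected.exists_adj_dist_eq (hG : G.Connected) {u v : V} {d : ℕ}
    (h : G.dist v u = d + 1) : ∃ w, G.Adj v w ∧ G.dist w u = d := by
  obtain ⟨p, hp⟩ := hG.exists_walk_length_eq_dist v u
  cases p with
  | nil => simp at h
  | @cons _ w _ hvw q =>
    refine ⟨w, hvw, ?_⟩
    have h1 := dist_le q
    have h2 := hG.dist_triangle (u := v) (v := w) (w := u)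
    have h3 := dist_eq_one_iff_adj.2 hvw
    simp only [Walk.length_cons] at hp
    omega

theorem Connected.exists_dist_eq_dist_eq (hG : G.Connected) {u v : V} {d k : ℕ}
    (h : G.dist v u = k + d) : ∃ w, G.dist v w = k ∧ G.dist w u = d := by
  induction k generalizing v with
  | zero => exact ⟨v, by simp, by omega⟩
  | succ k ih =>
    obtain ⟨w, hvw, hw⟩ := hG.exists_adj_dist_eq (u := u) (v := v) (d := k + d) (by omega)
    obtain ⟨x, hx, hxu⟩ := ih hw
    refine ⟨x, ?_, hxu⟩
    have h1 := hG.dist_triangle (u := v) (v := w) (w := x)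
    have h2 := hG.dist_triangle (u := v) (v := x) (w := u)
    have h3 := dist_eq_one_iff_adj.2 hvw
    omega

theorem exists_dist_le_of_maximal {α : Set V}
    (hα : Maximal G.IsIndepSet α) (v : V) : ∃ a ∈ α, G.dist v a ≤ 1 := by
  by_contra! hcon
  have hvα : v ∉ α := fun hv => by simpa using hcon v hv
  have hadj : ∀ a ∈ α, ¬ G.Adj v a := fun a ha hva => by
    have := hcon a ha
    rw [dist_eq_one_iff_adj.2 hva] at this
    omega
  refine hvα (hα.2 (y := insert v α) ?_ (Set.subset_insert v α) (Set.mem_insert v α))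
  have hα1 : G.IsIndepSet α := hα.1
  rw [isIndepSet_iff] at hα1 ⊢
  exact hα1.insert fun a ha _ => ⟨hadj a ha, fun h => hadj a ha h.symm⟩

/-- Every node is within distance `d` of `S`. -/
def Dominates (G : SimpleGraph V) (d : ℕ) (S : Set V) : Prop :=
  ∀ v, ∃ u ∈ S, G.dist v u ≤ d

theorem Dominates.mono {d d' : ℕ} {S T : Set V} (h : G.Dominates d S) (hd : d ≤ d')
    (hST : S ⊆ T) : G.Dominates d' T := fun v =>
  let ⟨u, hu, hvu⟩ := h v
  ⟨u, hST hu, hvu.trans hd⟩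

theorem Connected.isRulingSet (hG : G.Connected) {d : ℕ} {S : Set V} (hS : G.IsIndepSet S)
    (hd : G.Dominates d S) : IsRulingSet G 2 d S := by
  constructor
  · intro u hu v hv huv
    have h1 := hG.one_lt_dist_of_ne_of_not_adj huv (hS hu hv huv)
    rw [← (hG u v).coe_dist_eq_edist]
    exact_mod_cast h1
  · intro v _
    obtain ⟨u, hu, hvu⟩ := hd v
    refine ⟨u, hu, ?_⟩
    rw [← (hG v u).coe_dist_eq_edist]
    exact_mod_cast hvu

/-- `X` is a maximal subset of `C` whose points have pairwise distance more than `d`. -/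
structure IsNet (G : SimpleGraph V) (d : ℕ) (C X : Set V) : Prop where
  subset : X ⊆ C
  separated : ∀ x ∈ X, ∀ y ∈ X, x ≠ y → d < G.dist x y
  covers : ∀ v ∈ C, ∃ x ∈ X, G.dist v x ≤ d

theorem IsNet.isIndepSet {d : ℕ} {C X : Set V} (h : G.IsNet d C X) (hd : 1 ≤ d) :
    G.IsIndepSet X := fun x hx y hy hxy hadj => by
  have := h.separated x hx y hy hxy
  rw [dist_eq_one_iff_adj.2 hadj] at this
  omega

/-! ### Cores -/

/-- The nodes whose closed ball of radius `2` contains no smaller closed ball of radius `2`. -/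
def cores (G : SimpleGraph V) : Set V :=
  {r | ∀ w, G.dist r w ≤ 2 → {x | G.dist w x ≤ 2} ⊆ {x | G.dist r x ≤ 2} →
    {x | G.dist w x ≤ 2} = {x | G.dist r x ≤ 2}}

/-- Descend to strictly smaller 2-balls. They stay nested, so the core reached at the end still lies
in the 2-ball of the starting node, however long the descent. -/
theorem dominates_cores [Finite V] : G.Dominates 2 G.cores := by
  intro v
  induction hN : Set.ncard {x | G.dist v x ≤ 2} using Nat.strong_induction_on generalizing v with
  | _ N ih =>
    by_cases hv : v ∈ G.cores
    · exact ⟨v, hv, by simp⟩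
    · simp only [cores, Set.mem_ofPred_eq, not_forall] at hv
      obtain ⟨w, -, hsub, hne⟩ := hv
      have hss := Set.ssubset_iff_subset_ne.2 ⟨hsub, hne⟩
      obtain ⟨u, hu, hwu⟩ := ih _ (hN ▸ Set.ncard_lt_ncard hss (Set.toFinite _)) w rfl
      exact ⟨u, hu, hsub hwu⟩

/-- The part of `α` that is left after removing all neighbors of `R`. -/
def clearing (G : SimpleGraph V) (α R : Set V) : Set V :=
  {a | a ∈ α ∧ ∀ r ∈ R, ¬ G.Adj r a}

theorem clearing_empty (α : Set V) : G.clearing α ∅ = α := by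
  simp [clearing]

theorem clearing_anti {α R R' : Set V} (h : R ⊆ R') : G.clearing α R' ⊆ G.clearing α R :=
  fun _ ha => ⟨ha.1, fun r hr => ha.2 r (h hr)⟩

theorem IsIndepSet.clearing_union {α R R' : Set V} (hα : G.IsIndepSet α) (hR : G.IsIndepSet R)
    (h : R ⊆ R') : G.IsIndepSet (G.clearing α R' ∪ R) := by
  rintro x (hx | hx) y (hy | hy) hxy
  · exact hα hx.1 hy.1 hxy
  · exact fun hadj => hx.2 y (h hy) hadj.symm
  · exact hy.2 x (h hx)
  · exact hR hx hy hxy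

/-- If the 2-ball of a core were the whole graph, minimality would make every 2-ball the whole
graph, contradicting the large diameter. -/
theorem Connected.exists_dist_gt_two (hG : G.Connected) (hdiam : 3 < G.ediam) {r : V}
    (hr : r ∈ G.cores) : ∃ x, 2 < G.dist r x := by
  by_contra! hcon
  have hall : ∀ w, {x | G.dist w x ≤ 2} = {x | G.dist r x ≤ 2} := fun w =>
    hr w (hcon w) fun x _ => hcon x
  have : G.ediam ≤ 3 := ediam_le_of_edist_le fun u v => by
    rw [← (hG u v).coe_dist_eq_edist]
    have h : v ∈ {x | G.dist u x ≤ 2} := (hall u).symm ▸ hcon v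
    have h' : G.dist u v ≤ 3 := le_trans h (by omega)
    exact_mod_cast h'
  exact absurd this (not_le.2 hdiam)

/-- Clearing around well separated cores leaves a `4`-dominating set. -/
theorem Connected.dominates_clearing_of_isNet (hG : G.Connected) (hdiam : 3 < G.ediam)
    {α Q : Set V} (hα : Maximal G.IsIndepSet α) (hQ : G.IsNet 6 G.cores Q) :
    G.Dominates 4 (G.clearing α Q) := by
  intro w
  obtain ⟨a, ha, hwa⟩ := exists_dist_le_of_maximal hα w
  by_cases haQ : ∀ r ∈ Q, ¬ G.Adj r a
  · exact ⟨a, ⟨ha, haQ⟩, by omega⟩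
  push Not at haQ
  obtain ⟨r, hr, hra⟩ := haQ
  have hra1 := dist_eq_one_iff_adj.2 hra
  have hrw : G.dist r w ≤ 2 := by
    have := hG.dist_triangle (u := r) (v := a) (w := w)
    rw [dist_comm (u := a)] at this
    omega
  -- If the 2-ball of `w` leaves that of `r`, any node in the difference serves. Otherwise the balls
  -- agree because `r` is a core, so a node at distance 2 from `r` on a geodesic to a node at
  -- distance 3 is also within 2 of `w`.
  obtain ⟨z, hwz, hrz, hrz'⟩ : ∃ z, G.dist w z ≤ 3 ∧ 2 < G.dist r z ∧ G.dist r z ≤ 4 := by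
    by_cases hsub : {x | G.dist w x ≤ 2} ⊆ {x | G.dist r x ≤ 2}
    · have heq := hQ.subset hr w hrw hsub
      obtain ⟨x, hx⟩ := hG.exists_dist_gt_two hdiam (hQ.subset hr)
      obtain ⟨z, hz, -⟩ := hG.exists_dist_eq_dist_eq (v := r) (u := x) (k := 3)
        (d := G.dist r x - 3) (by omega)
      obtain ⟨y, hy, hyz⟩ := hG.exists_dist_eq_dist_eq (v := r) (u := z) (k := 2) (d := 1) hz
      have hwy : y ∈ {x | G.dist w x ≤ 2} := heq ▸ hy.le
      have hwy' : G.dist w y ≤ 2 := hwy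
      have := hG.dist_triangle (u := w) (v := y) (w := z)
      exact ⟨z, by omega, by omega, by omega⟩
    · obtain ⟨z, hz, hz'⟩ := Set.not_subset.1 hsub
      simp only [Set.mem_ofPred_eq, not_le] at hz hz'
      have := hG.dist_triangle (u := r) (v := w) (w := z)
      exact ⟨z, by omega, hz', by omega⟩
  obtain ⟨b, hb, hzb⟩ := exists_dist_le_of_maximal hα z
  have h1 := hG.dist_triangle (u := w) (v := z) (w := b)
  refine ⟨b, ⟨hb, fun r' hr' hadj => ?_⟩, by omega⟩
  have hrb := dist_eq_one_iff_adj.2 hadj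
  have h2 := hG.dist_triangle (u := r) (v := z) (w := b)
  have h3 := hG.dist_triangle (u := r) (v := b) (w := r')
  have h4 := hG.dist_triangle (u := r) (v := b) (w := z)
  rw [dist_comm (u := b) (v := r')] at h3
  rw [dist_comm (u := b) (v := z)] at h4
  -- The distance from `r` to `b` lies between 2 and 5: too far for `b` to be adjacent to `r`, too
  -- close for it to be adjacent to another node of `Q`, which is at distance at least 7 from `r`.
  by_cases hrr : r = r'
  · subst hrr
    omega
  · have := hQ.separated r hr r' hr' hrr
    omega

/-! ### Growing the set of permanent nodes -/

/-- `R 0 = ∅`, `R 1` is a net of cores, and `R (i + 1)` arises from `R i` by adding a maximal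
independent set of the nodes at distance exactly `2` from `R i`. -/
structure IsGrowth (G : SimpleGraph V) (R : ℕ → Set V) : Prop where
  zero : R 0 = ∅
  one : G.IsNet 6 G.cores (R 1)
  succ : ∀ i, 1 ≤ i → ∃ Z, R (i + 1) = R i ∪ Z ∧
    G.IsNet 1 {v | (∃ u ∈ R i, G.dist v u ≤ 2) ∧ ∀ u ∈ R i, ¬ G.dist v u ≤ 1} Z

namespace IsGrowth

variable {R : ℕ → Set V}

theorem subset_succ (hR : G.IsGrowth R) (i : ℕ) : R i ⊆ R (i + 1) := by
  rcases Nat.eq_zero_or_pos i with rfl | hi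
  · simp [hR.zero]
  · obtain ⟨Z, hZ, -⟩ := hR.succ i hi
    exact hZ ▸ Set.subset_union_left

theorem monotone (hR : G.IsGrowth R) : Monotone R := monotone_nat_of_le_succ hR.subset_succ

theorem isIndepSet (hR : G.IsGrowth R) (i : ℕ) : G.IsIndepSet (R i) := by
  induction i with
  | zero => simp [hR.zero]
  | succ i ih =>
    rcases Nat.eq_zero_or_pos i with rfl | hi
    · exact hR.one.isIndepSet (by norm_num)
    · obtain ⟨Z, hZ, hnet⟩ := hR.succ i hi
      have key : ∀ z ∈ Z, ∀ u ∈ R i, ¬ G.Adj z u := fun z hz u hu hadj =>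
        (hnet.subset hz).2 u hu (dist_eq_one_iff_adj.2 hadj).le
      rw [hZ]
      rintro x (hx | hx) y (hy | hy) hxy
      · exact ih hx hy hxy
      · exact fun hadj => key y hy x hx hadj.symm
      · exact key x hx y hy
      · exact hnet.isIndepSet le_rfl hx hy hxy

theorem dominates_one [Finite V] (hR : G.IsGrowth R) (hG : G.Connected) :
    G.Dominates 8 (R 1) := fun v => by
  obtain ⟨u, hu, hvu⟩ := dominates_cores (G := G) v
  obtain ⟨x, hx, hux⟩ := hR.one.covers u hu
  have := hG.dist_triangle (u := v) (v := u) (w := x)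
  exact ⟨x, hx, by omega⟩

/-- A node at distance exactly `d + 1` from `R i` has, on a geodesic to `R i`, a node at distance
exactly 2 from `R i`. That node is a candidate for `Z`, so it is in `Z` or has a neighbour there. -/
theorem dominates_succ (hR : G.IsGrowth R) (hG : G.Connected) {i d : ℕ} (hi : 1 ≤ i)
    (hd : 1 ≤ d) (h : G.Dominates (d + 1) (R i)) : G.Dominates d (R (i + 1)) := fun v => by
  obtain ⟨Z, hZ, hnet⟩ := hR.succ i hi
  rw [hZ]
  by_cases hv : ∃ u ∈ R i, G.dist v u ≤ d
  · obtain ⟨u, hu, hvu⟩ := hv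
    exact ⟨u, Or.inl hu, hvu⟩
  push Not at hv
  obtain ⟨u, hu, hvu⟩ := h v
  have hvu' := hv u hu
  obtain ⟨w, hvw, hwu⟩ := hG.exists_dist_eq_dist_eq (v := v) (u := u) (k := d - 1) (d := 2)
    (by omega)
  obtain ⟨z, hz, hwz⟩ := hnet.covers w ⟨⟨u, hu, hwu.le⟩, fun u' hu' hwu' => by
    have h1 := hv u' hu'
    have h2 := hG.dist_triangle (u := v) (v := w) (w := u')
    omega⟩
  have := hG.dist_triangle (u := v) (v := w) (w := z)
  exact ⟨z, Or.inr hz, by omega⟩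

theorem dominates_five [Finite V] (hR : G.IsGrowth R) (hG : G.Connected) :
    G.Dominates 4 (R 5) :=
  hR.dominates_succ hG (by norm_num) (by norm_num) <|
    hR.dominates_succ hG (by norm_num) (by norm_num) <|
      hR.dominates_succ hG (by norm_num) (by norm_num) <|
        hR.dominates_succ hG le_rfl (by norm_num) (hR.dominates_one hG)

theorem dominates_clearing (hR : G.IsGrowth R) (hG : G.Connected) (hdiam : 3 < G.ediam)
    {α : Set V} (hα : Maximal G.IsIndepSet α) (i : ℕ) :
    G.Dominates 4 (G.clearing α (R (i + 1)) ∪ R i) := by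
  rcases Nat.eq_zero_or_pos i with rfl | hi
  · exact (hG.dominates_clearing_of_isNet hdiam hα hR.one).mono le_rfl Set.subset_union_left
  intro w
  obtain ⟨Z, hZ, hnet⟩ := hR.succ i hi
  obtain ⟨a, ha, hwa⟩ := exists_dist_le_of_maximal hα w
  by_cases haR : ∀ r ∈ R (i + 1), ¬ G.Adj r a
  · exact ⟨a, Or.inl ⟨ha, haR⟩, by omega⟩
  push Not at haR
  obtain ⟨r, hr, hra⟩ := haR
  have hra1 := dist_eq_one_iff_adj.2 hra.symm
  have hwr := hG.dist_triangle (u := w) (v := a) (w := r)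
  rw [hZ] at hr
  rcases hr with hr | hr
  · exact ⟨r, Or.inr hr, by omega⟩
  · obtain ⟨⟨u, hu, hru⟩, -⟩ := hnet.subset hr
    have := hG.dist_triangle (u := w) (v := r) (w := u)
    exact ⟨u, Or.inr hu, by omega⟩

/-- The `k`-th set on the way from `α` to the permanent nodes. -/
def halfSchedule (G : SimpleGraph V) (R : ℕ → Set V) (α : Set V) (k : ℕ) : Set V :=
  G.clearing α (R ((k + 1) / 2)) ∪ R (k / 2)

theorem halfSchedule_zero (hR : G.IsGrowth R) (α : Set V) : halfSchedule G R α 0 = α := by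
  simp [halfSchedule, hR.zero, clearing_empty]

theorem isIndepSet_halfSchedule (hR : G.IsGrowth R) {α : Set V} (hα : G.IsIndepSet α) (k : ℕ) :
    G.IsIndepSet (halfSchedule G R α k) :=
  hα.clearing_union (hR.isIndepSet _) (hR.monotone (by omega))

theorem dominates_halfSchedule (hR : G.IsGrowth R) (hG : G.Connected) (hdiam : 3 < G.ediam)
    {α : Set V} (hα : Maximal G.IsIndepSet α) {k : ℕ} (hk : 0 < k) :
    G.Dominates 4 (halfSchedule G R α k) := by
  -- The critical case is odd `k`: the room for `R (i + 1)` has been cleared, but only `R i` is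
  -- present. For even `k` the set is larger.
  obtain ⟨i, hi⟩ : ∃ i, (k + 1) / 2 = i + 1 := ⟨(k + 1) / 2 - 1, by omega⟩
  refine (hR.dominates_clearing hG hdiam hα i).mono le_rfl ?_
  rw [halfSchedule, hi]
  exact Set.union_subset_union_right _ (hR.monotone (by omega))

theorem halfSchedule_succ (hR : G.IsGrowth R) (α : Set V) (k : ℕ) :
    halfSchedule G R α k ⊆ halfSchedule G R α (k + 1) ∨
      halfSchedule G R α (k + 1) ⊆ halfSchedule G R α k := by
  obtain ⟨j, rfl | rfl⟩ := k.even_or_odd'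
  · right
    rw [halfSchedule, halfSchedule, show (2 * j + 1 + 1) / 2 = j + 1 by omega,
      show (2 * j + 1) / 2 = j by omega, show 2 * j / 2 = j by omega]
    exact Set.union_subset_union_left _ (clearing_anti (hR.subset_succ j))
  · left
    rw [halfSchedule, halfSchedule, show (2 * j + 1 + 1 + 1) / 2 = j + 1 by omega,
      show (2 * j + 1 + 1) / 2 = j + 1 by omega, show (2 * j + 1) / 2 = j by omega]
    exact Set.union_subset_union_right _ (hR.subset_succ j)

/-- The reconfiguration schedule of length `28` through the permanent nodes. -/
def schedule (G : SimpleGraph V) (R : ℕ → Set V) (α β : Set V) (k : ℕ) : Set V :=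
  if k ≤ 10 then halfSchedule G R α k
  else if k < 18 then R 5
  else halfSchedule G R β (28 - k)

theorem isIndepSet_symmDiff {S T : Set V} (hS : G.IsIndepSet S) (hT : G.IsIndepSet T)
    (h : S ⊆ T ∨ T ⊆ S) : G.IsIndepSet (symmDiff T S) := by
  rcases h with h | h
  · exact Set.Pairwise.mono (by rw [symmDiff_of_ge h]; exact Set.sdiff_subset) hT
  · exact Set.Pairwise.mono (by rw [symmDiff_of_le h]; exact Set.sdiff_subset) hS

theorem isReconfigurationSchedule [Finite V] (hR : G.IsGrowth R) (hG : G.Connected)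
    (hdiam : 3 < G.ediam) {α β : Set V} (hα : Maximal G.IsIndepSet α)
    (hβ : Maximal G.IsIndepSet β) :
    IsReconfigurationSchedule G (fun H U => IsRulingSet H 2 4 U) α β 28
      (fun i => schedule G R α β i) := by
  have hindep : ∀ k, G.IsIndepSet (schedule G R α β k) := fun k => by
    unfold schedule
    split_ifs
    · exact hR.isIndepSet_halfSchedule hα.1 k
    · exact hR.isIndepSet 5
    · exact hR.isIndepSet_halfSchedule hβ.1 _
  refine ⟨?_, ?_, ?_, ?_⟩
  · simp [schedule, hR.halfSchedule_zero]
  · simp [schedule, hR.halfSchedule_zero]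
  · intro i hi hi'
    refine hG.isRulingSet (hindep _) ?_
    have h0 : 0 < (i : ℕ) := hi
    have h1 : (i : ℕ) < 28 := hi'
    unfold schedule
    split_ifs
    · exact hR.dominates_halfSchedule hG hdiam hα h0
    · exact hR.dominates_five hG
    · exact hR.dominates_halfSchedule hG hdiam hβ (by omega)
  · intro i
    refine isIndepSet_symmDiff (hindep _) (hindep _) ?_
    have hi := i.isLt
    simp only [Fin.val_castSucc, Fin.val_succ, schedule]
    generalize (i : ℕ) = k at hi
    by_cases h1 : k + 1 ≤ 10
    · rw [if_pos h1, if_pos (by omega)]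
      exact hR.halfSchedule_succ α k
    by_cases h2 : k ≤ 10
    · rw [if_pos h2, if_neg h1, if_pos (by omega)]
      -- The step from 10 to 11 drops what is left of `α`.
      obtain rfl : k = 10 := by omega
      exact Or.inr Set.subset_union_right
    rw [if_neg h2, if_neg h1]
    -- The sets 11 to 17 coincide; the six idle steps only pad the length to 28.
    by_cases h3 : k + 1 < 18
    · rw [if_pos h3, if_pos (by omega)]
      exact Or.inl subset_rfl
    rw [if_neg h3]
    by_cases h4 : k < 18
    · rw [if_pos h4]
      obtain rfl : k = 17 := by omega
      exact Or.inl Set.subset_union_right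
    · rw [if_neg h4, show 28 - k = 28 - (k + 1) + 1 by omega]
      exact (hR.halfSchedule_succ β _).symm

end IsGrowth

end SimpleGraph

/-! ### Local computation -/

/-- What a node knows after `t` rounds in which all nodes exchange all that they know. -/
def View (In : Type) : ℕ → Type
  | 0 => ℕ × ℕ × In
  | t + 1 => View In t × Multiset (View In t)

/-- The number of nodes of the network, as recorded in a view. -/
def View.size {In : Type} : ∀ {t : ℕ}, View In t → ℕ
  | 0, x => x.1
  | _ + 1, x => View.size x.1

/-- A connected network on `n` nodes with maximum degree at most `Δ` and distinct identifiers of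
size at most `n ^ c`. -/
structure Network (In : Type) (Δ c n : ℕ) where
  V : Type*
  [fintype : Fintype V]
  G : SimpleGraph V
  [decAdj : DecidableRel G.Adj]
  ident : V → ℕ
  input : V → In
  card_eq : Fintype.card V = n
  connected : G.Connected
  degree_le : ∀ v, G.degree v ≤ Δ
  ident_injective : Function.Injective ident
  ident_le : ∀ v, ident v ≤ n ^ c

attribute [instance] Network.fintype Network.decAdj

universe u

namespace Network

variable {In : Type} {Δ c n : ℕ}

/-- The view of each node after `t` rounds. -/
def view (N : Network In Δ c n) : ∀ t, N.V → View In t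
  | 0, v => (n, N.ident v, N.input v)
  | t + 1, v => (view N t v, (N.G.neighborFinset v).val.map (view N t))

theorem size_view (N : Network In Δ c n) (t : ℕ) (v : N.V) : (N.view t v).size = n := by
  induction t with
  | zero => rfl
  | succ t ih => exact ih

end Network

/-- A labeling of the nodes of all networks. -/
abbrev Labeling (In : Type) (Δ c n : ℕ) (X : Type) : Type (u + 1) :=
  ∀ N : Network.{u} In Δ c n, N.V → X

section Labeling

variable {In X Y : Type} {Δ c n : ℕ}

/-- A labeling is `t`-local if the label of a node is a function of its view after `t` rounds. -/
def IsLocal (t : ℕ) (F : Labeling.{u} In Δ c n X) : Prop :=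
  ∃ f : View In t → X, ∀ N v, F N v = f (N.view t v)

theorem isLocal_ident : IsLocal 0 (fun N v => N.ident v : Labeling.{u} In Δ c n ℕ) :=
  ⟨fun x => x.2.1, fun _ _ => rfl⟩

theorem isLocal_input : IsLocal 0 (fun N v => N.input v : Labeling.{u} In Δ c n In) :=
  ⟨fun x => x.2.2, fun _ _ => rfl⟩

namespace IsLocal

theorem const (x : X) : IsLocal 0 (fun _ _ => x : Labeling.{u} In Δ c n X) :=
  ⟨fun _ => x, fun _ _ => rfl⟩

theorem map {t : ℕ} {F : Labeling.{u} In Δ c n X} (hF : IsLocal t F) (g : X → Y) :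
    IsLocal t (fun N v => g (F N v) : Labeling.{u} In Δ c n Y) := by
  obtain ⟨f, hf⟩ := hF
  exact ⟨fun x => g (f x), fun N v => congrArg g (hf N v)⟩

theorem pair {t : ℕ} {F : Labeling.{u} In Δ c n X} {F' : Labeling.{u} In Δ c n Y}
    (hF : IsLocal t F) (hF' : IsLocal t F') :
    IsLocal t (fun N v => (F N v, F' N v) : Labeling.{u} In Δ c n (X × Y)) := by
  obtain ⟨f, hf⟩ := hF
  obtain ⟨f', hf'⟩ := hF'
  exact ⟨fun x => (f x, f' x), fun N v => congrArg₂ Prod.mk (hf N v) (hf' N v)⟩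

theorem mono {t t' : ℕ} {F : Labeling.{u} In Δ c n X} (hF : IsLocal t F) (h : t ≤ t') :
    IsLocal t' F := by
  induction h with
  | refl => exact hF
  | step _ ih =>
    obtain ⟨f, hf⟩ := ih
    exact ⟨fun x => f x.1, hf⟩

theorem pi {ι : Type} {t : ℕ} {F : ι → Labeling.{u} In Δ c n X} (hF : ∀ i, IsLocal t (F i)) :
    IsLocal t (fun N v i => F i N v : Labeling.{u} In Δ c n (ι → X)) := by
  choose f hf using hF
  exact ⟨fun x i => f i x, fun N v => funext fun i => hf i N v⟩

theorem map₂ {Z : Type} {t t' : ℕ} {F : Labeling.{u} In Δ c n X} {F' : Labeling.{u} In Δ c n Y}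
    (hF : IsLocal t F) (hF' : IsLocal t' F') (g : X → Y → Z) :
    IsLocal (max t t') (fun N v => g (F N v) (F' N v) : Labeling.{u} In Δ c n Z) :=
  ((hF.mono (le_max_left t t')).pair (hF'.mono (le_max_right t t'))).map fun p => g p.1 p.2

theorem neighbors {t : ℕ} {F : Labeling.{u} In Δ c n X} (hF : IsLocal t F) :
    IsLocal (t + 1) (fun N v => {x | ∃ w, N.G.Adj v w ∧ F N w = x} :
      Labeling.{u} In Δ c n (Set X)) := by
  obtain ⟨f, hf⟩ := hF
  refine ⟨fun x => {y | y ∈ x.2.map f}, fun N v => ?_⟩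
  ext y
  simp [Network.view, hf]

end IsLocal

/-- The set of the labels in the closed ball of radius `d`. -/
def ballLabels (F : Labeling.{u} In Δ c n X) (d : ℕ) : Labeling.{u} In Δ c n (Set X) :=
  fun N v => F N '' {w | N.G.dist v w ≤ d}

theorem ballLabels_zero (F : Labeling.{u} In Δ c n X) :
    ballLabels F 0 = fun N v => {F N v} := by
  funext N v
  have : {w | N.G.dist v w ≤ 0} = {v} := by
    ext w
    rw [Set.mem_ofPred_eq, Nat.le_zero, N.connected.dist_eq_zero_iff]
    exact eq_comm
  rw [ballLabels, this, Set.image_singleton]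

theorem ballLabels_succ (F : Labeling.{u} In Δ c n X) (d : ℕ) (N : Network.{u} In Δ c n)
    (v : N.V) : ballLabels F (d + 1) N v =
      ballLabels F d N v ∪ ⋃ w ∈ N.G.neighborFinset v, ballLabels F d N w := by
  ext x
  simp only [ballLabels, Set.mem_image, Set.mem_ofPred_eq, Set.mem_union, Set.mem_iUnion,
    SimpleGraph.mem_neighborFinset, exists_prop]
  constructor
  · rintro ⟨z, hz, rfl⟩
    rcases Nat.lt_or_ge d (N.G.dist v z) with h | h
    · obtain ⟨w, hvw, hw⟩ := N.connected.exists_adj_dist_eq (v := v) (u := z) (d := d) (by omega)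
      exact Or.inr ⟨w, hvw, z, hw.le, rfl⟩
    · exact Or.inl ⟨z, h, rfl⟩
  · rintro (⟨z, hz, rfl⟩ | ⟨w, hvw, z, hz, rfl⟩)
    · exact ⟨z, by omega, rfl⟩
    · have h1 := N.connected.dist_triangle (u := v) (v := w) (w := z)
      have h2 := SimpleGraph.dist_eq_one_iff_adj.2 hvw
      exact ⟨z, by omega, rfl⟩

theorem IsLocal.ballLabels {t : ℕ} {F : Labeling.{u} In Δ c n X} (hF : IsLocal t F) (d : ℕ) :
    IsLocal (t + d) (ballLabels F d) := by
  induction d with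
  | zero =>
    rw [ballLabels_zero]
    exact hF.map fun x => ({x} : Set X)
  | succ d ih =>
    have h := (ih.map₂ ih.neighbors fun s T => s ∪ ⋃₀ T).mono
      (t' := t + (d + 1)) (by omega)
    convert h using 3 with N v
    rw [ballLabels_succ]
    congr 1
    ext x
    simp

theorem ncard_ballLabels_le (F : Labeling.{u} In Δ c n X) (d : ℕ) (N : Network.{u} In Δ c n)
    (v : N.V) : (ballLabels F d N v).ncard ≤ (Δ + 1) ^ d := by
  induction d generalizing v with
  | zero => simp [ballLabels_zero]
  | succ d ih =>
    have h1 : (⋃ w ∈ N.G.neighborFinset v, ballLabels F d N w).ncard ≤ Δ * (Δ + 1) ^ d :=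
      calc _ ≤ ∑ w ∈ N.G.neighborFinset v, (ballLabels F d N w).ncard :=
            Finset.set_ncard_biUnion_le _ _
        _ ≤ ∑ _w ∈ N.G.neighborFinset v, (Δ + 1) ^ d := Finset.sum_le_sum fun w _ => ih w
        _ ≤ Δ * (Δ + 1) ^ d := by
            rw [Finset.sum_const, smul_eq_mul, SimpleGraph.card_neighborFinset_eq_degree]
            exact Nat.mul_le_mul_right _ (N.degree_le v)
    calc _ ≤ (ballLabels F d N v).ncard + _ :=
          ballLabels_succ F d N v ▸ Set.ncard_union_le _ _
      _ ≤ (Δ + 1) ^ d + Δ * (Δ + 1) ^ d := add_le_add (ih v) h1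
      _ = (Δ + 1) ^ (d + 1) := by ring

end Labeling

/-! ### The full-information algorithm -/

section Gather

variable {In Out : Type}

/-- The algorithm that gathers views for `T n` rounds and then applies `f n`. -/
noncomputable def gatherAlgorithm (T : ℕ → ℕ) (f : ∀ n, View In (T n) → Out) (default : Out) :
    LocalAlgorithm In Out where
  State := Σ t, View In t
  Msg := Σ t, View In t
  init n i x := ⟨0, (n, i, x)⟩
  send s := s
  receive s M := ⟨s.1 + 1, (s.2, M.filterMap fun m =>
    if h : m.1 = s.1 then some (h ▸ m.2) else none)⟩
  rounds := T
  output s := if h : s.1 = T s.2.size then f _ (h ▸ s.2) else default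

variable {Δ c n : ℕ} (T : ℕ → ℕ) (f : ∀ n, View In (T n) → Out) (default : Out)

/-- All nodes have the same round counter, so the index test in `receive` always succeeds and no
message is discarded. -/
theorem stateAfter_gatherAlgorithm (N : Network.{u} In Δ c n) (t : ℕ) (v : N.V) :
    (gatherAlgorithm T f default).stateAfter N.G N.ident N.input t v = ⟨t, N.view t v⟩ := by
  induction t generalizing v with
  | zero => simp [LocalAlgorithm.stateAfter, gatherAlgorithm, Network.view, N.card_eq]
  | succ t ih =>
    rw [LocalAlgorithm.stateAfter]
    simp only [ih]
    simp only [gatherAlgorithm, Network.view, Multiset.filterMap_map, Function.comp_def,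
      dite_true]
    congr 2
    exact Multiset.filterMap_eq_map _ ▸ rfl

theorem run_gatherAlgorithm (N : Network.{u} In Δ c n) (v : N.V) :
    (gatherAlgorithm T f default).run N.G N.ident N.input v = f n (N.view (T n) v) := by
  rw [LocalAlgorithm.run, stateAfter_gatherAlgorithm, N.card_eq]
  change (if h : T n = T (N.view (T n) v).size then
    f _ (h ▸ N.view (T n) v : View In (T (N.view (T n) v).size)) else default) = _
  -- Generalizing the recorded size to a variable `m` lets the casts be removed by substitution.
  have key : ∀ (m : ℕ) (x : View In (T n)) (_ : m = n),
      (if h : T n = T m then f m (h ▸ x : View In (T m)) else default) = f n x := by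
    rintro m x rfl
    simp
  exact key _ _ (N.size_view _ _)

end Gather

/-! ### Iterated color reduction -/

/-- The least position at which the binary expansions of `a` and `b` differ. -/
noncomputable def diffBit (a b : ℕ) : ℕ := sInf {i | a.testBit i ≠ b.testBit i}

theorem testBit_diffBit_ne {a b : ℕ} (h : a ≠ b) :
    a.testBit (diffBit a b) ≠ b.testBit (diffBit a b) := by
  refine Nat.sInf_mem (s := {i | a.testBit i ≠ b.testBit i}) ?_
  by_contra hcon
  refine h (Nat.eq_of_testBit_eq fun i => ?_)
  by_contra hi
  exact hcon ⟨i, hi⟩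

theorem diffBit_lt {a b L : ℕ} (h : a ≠ b) (ha : a < 2 ^ L) (hb : b < 2 ^ L) :
    diffBit a b < L := by
  by_contra! hL
  refine testBit_diffBit_ne h ?_
  have hpow := Nat.pow_le_pow_right (n := 2) (by norm_num) hL
  rw [Nat.testBit_lt_two_pow (ha.trans_le hpow), Nat.testBit_lt_two_pow (hb.trans_le hpow)]

/-- For every other color of `s`, a position where `a` differs from it, with the bit of `a`. -/
noncomputable def palette (a : ℕ) (s : Set ℕ) : Set (ℕ × Bool) :=
  (fun b => (diffBit a b, a.testBit (diffBit a b))) '' (s \ {a})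

/-- The palette of `a` records the bit of `a` at a position where `b` differs, while the palette of
`b` records only bits of `b`. -/
theorem palette_ne {a b : ℕ} {s s' : Set ℕ} (h : a ≠ b) (hb : b ∈ s) :
    palette a s ≠ palette b s' := by
  intro heq
  have hmem : (diffBit a b, a.testBit (diffBit a b)) ∈ palette b s' :=
    heq ▸ ⟨b, ⟨hb, h.symm⟩, rfl⟩
  obtain ⟨x, -, hx⟩ := hmem
  obtain ⟨h1, h2⟩ := Prod.mk.inj hx
  rw [h1] at h2
  exact testBit_diffBit_ne h h2.symm

/-- Every nonempty set of at most `D + 1` elements arises by inserting one element into a set of at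
most `D`. -/
theorem card_powerset_filter_card_le {X : Type*} [DecidableEq X] (A : Finset X) (D : ℕ) :
    (A.powerset.filter fun t => t.card ≤ D).card ≤ (A.card + 1) ^ D := by
  induction D with
  | zero =>
    rw [pow_zero, Finset.card_le_one]
    intro s hs t ht
    simp only [Finset.mem_filter, nonpos_iff_eq_zero, Finset.card_eq_zero] at hs ht
    rw [hs.2, ht.2]
  | succ D ih =>
    set P := A.powerset.filter fun t => t.card ≤ D
    have hsub : (A.powerset.filter fun t => t.card ≤ D + 1) ⊆
        P ∪ (A ×ˢ P).image fun p => insert p.1 p.2 := by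
      intro t ht
      simp only [Finset.mem_filter, Finset.mem_powerset] at ht
      rcases t.eq_empty_or_nonempty with rfl | ⟨x, hx⟩
      · simp [P]
      · refine Finset.mem_union_right _ (Finset.mem_image.2 ⟨(x, t.erase x), ?_, ?_⟩)
        · simp only [Finset.mem_product, P, Finset.mem_filter, Finset.mem_powerset]
          refine ⟨ht.1 hx, (Finset.erase_subset x t).trans ht.1, ?_⟩
          rw [Finset.card_erase_of_mem hx]
          omega
        · exact Finset.insert_erase hx
    calc _ ≤ (P ∪ (A ×ˢ P).image fun p => insert p.1 p.2).card := Finset.card_le_card hsub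
      _ ≤ P.card + A.card * P.card := (Finset.card_union_le _ _).trans
          (add_le_add le_rfl (Finset.card_image_le.trans (Finset.card_product _ _).le))
      _ = (A.card + 1) * P.card := by ring
      _ ≤ (A.card + 1) * (A.card + 1) ^ D := Nat.mul_le_mul_left _ ih
      _ = (A.card + 1) ^ (D + 1) := by ring

theorem exists_encoding {X : Type*} (A : Finset X) (D : ℕ) :
    ∃ e : Set X → ℕ, (∀ t ⊆ (A : Set X), t.ncard ≤ D → e t < (A.card + 1) ^ D) ∧
      Set.InjOn e {t | t ⊆ A ∧ t.ncard ≤ D} := by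
  classical
  set P := A.powerset.filter fun t => t.card ≤ D
  have hP : {t : Set X | t ⊆ A ∧ t.ncard ≤ D} = (fun t : Finset X => (t : Set X)) '' P := by
    ext t
    simp only [Set.mem_ofPred_eq, Set.mem_image, SetLike.mem_coe, P, Finset.mem_filter,
      Finset.mem_powerset]
    constructor
    · rintro ⟨h1, h2⟩
      have hfin := A.finite_toSet.subset h1
      refine ⟨hfin.toFinset, ⟨by simpa using h1, ?_⟩, by simp⟩
      rwa [← Set.ncard_eq_toFinset_card t hfin]
    · rintro ⟨s, ⟨h1, h2⟩, rfl⟩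
      exact ⟨by exact_mod_cast h1, by rwa [Set.ncard_coe_finset]⟩
  have hfin : {t : Set X | t ⊆ A ∧ t.ncard ≤ D}.Finite :=
    hP ▸ P.finite_toSet.image _
  have hcard : {t : Set X | t ⊆ A ∧ t.ncard ≤ D}.ncard ≤ (A.card + 1) ^ D := by
    rw [hP]
    refine (Set.ncard_image_le P.finite_toSet).trans ?_
    rw [Set.ncard_coe_finset]
    exact card_powerset_filter_card_le A D
  obtain ⟨e, he, hinj⟩ := hfin.exists_injOn_of_encard_le
    (t := (Finset.range ((A.card + 1) ^ D) : Set ℕ)) (by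
      rw [← hfin.cast_ncard_eq, Set.encard_coe_eq_coe_finsetCard, Finset.card_range]
      exact_mod_cast hcard)
  exact ⟨e, fun t h1 h2 => by simpa using he ⟨h1, h2⟩, hinj⟩

/-- If colors of `L` bits are recolored in balls with at most `D` colors, then the new colors have
`bitsStep D L` bits. -/
def bitsStep (D L : ℕ) : ℕ := D * (2 * L + 1).size

/-- The new colour is a code of the palette. Palettes have at most `D` elements among `2 * L` pairs,
so there are at most `(2 * L + 1) ^ D` of them. -/
theorem exists_recoloring (D L : ℕ) :
    ∃ g : ℕ → Set ℕ → ℕ, ∀ a s, a < 2 ^ L → s ⊆ Set.Iio (2 ^ L) → s.ncard ≤ D →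
      g a s < 2 ^ bitsStep D L ∧
        ∀ b s', b < 2 ^ L → s' ⊆ Set.Iio (2 ^ L) → s'.ncard ≤ D → a ≠ b → b ∈ s →
          g a s ≠ g b s' := by
  obtain ⟨e, he, hinj⟩ := exists_encoding (Finset.range L ×ˢ (Finset.univ : Finset Bool)) D
  have hpal : ∀ a s, a < 2 ^ L → s ⊆ Set.Iio (2 ^ L) → s.ncard ≤ D →
      palette a s ⊆ ((Finset.range L ×ˢ (Finset.univ : Finset Bool) : Finset _) : Set _) ∧
        (palette a s).ncard ≤ D := by
    intro a s ha hs hD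
    have hfin : s.Finite := (Set.finite_Iio _).subset hs
    refine ⟨?_, ?_⟩
    · rintro _ ⟨b, ⟨hb, hba⟩, rfl⟩
      simpa using diffBit_lt (Ne.symm hba) ha (hs hb)
    · exact (Set.ncard_image_le (hfin.subset Set.sdiff_subset)).trans
        ((Set.ncard_le_ncard Set.sdiff_subset hfin).trans hD)
  refine ⟨fun a s => e (palette a s), fun a s ha hs hD => ⟨?_, ?_⟩⟩
  · obtain ⟨h1, h2⟩ := hpal a s ha hs hD
    refine (he _ h1 h2).trans_le ?_
    rw [bitsStep, Finset.card_product, Finset.card_range, Finset.card_univ, Fintype.card_bool,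
      mul_comm D, pow_mul, mul_comm L]
    exact Nat.pow_le_pow_left (Nat.lt_size_self _).le D
  · intro b s' hb hs' hD' hab hbs heq
    exact palette_ne hab hbs (hinj (hpal a s ha hs hD) (hpal b s' hb hs' hD') heq)

/-! ### The number of color reductions -/

theorem natSize_le_logb_add_one {m : ℕ} (hm : 1 ≤ m) : (m.size : ℝ) ≤ Real.logb 2 m + 1 := by
  have h1 : 2 ^ (m.size - 1) ≤ m := by
    rw [← Nat.lt_size]
    have := Nat.size_pos.2 hm
    omega
  have h2 : ((m.size - 1 : ℕ) : ℝ) ≤ Real.logb 2 m := by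
    rw [Real.le_logb_iff_rpow_le (by norm_num) (by exact_mod_cast hm), Real.rpow_natCast]
    exact_mod_cast h1
  have h3 : (m.size : ℝ) ≤ ((m.size - 1 : ℕ) : ℝ) + 1 := by
    exact_mod_cast (by omega : m.size ≤ m.size - 1 + 1)
  linarith

theorem mul_add_eight_le (s : ℕ) : s * (s + 8) ≤ 2 ^ (s + 4) := by
  induction s with
  | zero => simp
  | succ s ih =>
    have : s + 1 ≤ 2 ^ s := Nat.lt_two_pow_self
    rw [pow_succ] at *
    nlinarith [pow_succ 2 s, pow_succ 2 (s + 1), pow_succ 2 (s + 2), pow_succ 2 (s + 3)]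

/-- Supplies the invariant of the iteration: while `x` runs through the iterated logarithms of `n`,
the bit length stays at most `A * max x 1`. The choice `A = 2 ^ (D + c + 4)` absorbs the factor `D`
and the additive constants of one step. -/
theorem exists_bits_bound (D c : ℕ) :
    ∃ A : ℕ, c + 1 ≤ A ∧ ∀ (L : ℕ) (x : ℝ), 1 ≤ x → (L : ℝ) ≤ A * x →
      (bitsStep D L : ℝ) ≤ A * max (Real.logb 2 x) 1 := by
  set s := D + c with hs
  refine ⟨2 ^ (s + 4), ?_, fun L x hx hL => ?_⟩
  · have := Nat.lt_two_pow_self (n := s + 4)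
    omega
  have hx0 : 0 < x := by linarith
  have hA : (1 : ℝ) ≤ 2 ^ (s + 4) := one_le_pow₀ (by norm_num)
  push_cast at hL
  have hAx : (1 : ℝ) ≤ 2 ^ (s + 4) * x := one_le_mul_of_one_le_of_one_le hA hx
  have h1 : (((2 * L + 1 : ℕ)) : ℝ) ≤ 2 ^ (s + 6) * x := by
    push_cast
    rw [show s + 6 = s + 4 + 2 by ring, pow_add _ (s + 4)]
    linarith
  have h2 : Real.logb 2 (2 * L + 1 : ℕ) ≤ (s + 6) + Real.logb 2 x := by
    refine (Real.logb_le_logb_of_le (by norm_num) (by positivity) h1).trans ?_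
    rw [Real.logb_mul (by positivity) hx0.ne', Real.logb_pow,
      Real.logb_self_eq_one (by norm_num)]
    push_cast
    linarith
  have h3 := natSize_le_logb_add_one (m := 2 * L + 1) (by omega)
  have hm1 : 1 ≤ max (Real.logb 2 x) 1 := le_max_right _ _
  have hm2 : Real.logb 2 x ≤ max (Real.logb 2 x) 1 := le_max_left _ _
  set y := max (Real.logb 2 x) 1
  have h4 : (((2 * L + 1).size : ℕ) : ℝ) ≤ (s + 8) * y := by
    have hs0 : (0 : ℝ) ≤ s := Nat.cast_nonneg s
    nlinarith
  have h5 : (D : ℝ) * (s + 8) ≤ 2 ^ (s + 4) := by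
    have h := mul_add_eight_le s
    have hD : D * (s + 8) ≤ s * (s + 8) := Nat.mul_le_mul_right _ (by omega)
    exact_mod_cast hD.trans h
  rw [bitsStep]
  push_cast at h4 ⊢
  calc (D : ℝ) * ((2 * L + 1).size : ℝ) ≤ D * ((s + 8) * y) :=
        mul_le_mul_of_nonneg_left h4 (Nat.cast_nonneg D)
    _ = D * (s + 8) * y := by ring
    _ ≤ 2 ^ (s + 4) * y := mul_le_mul_of_nonneg_right h5 (by linarith)

theorem exists_iterate_bitsStep_le (D c : ℕ) :
    ∃ A : ℕ, ∀ n : ℕ, ∃ i ≤ logStar n, (bitsStep D)^[i] (c * n.size + 1) ≤ A := by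
  obtain ⟨A, hcA, hA⟩ := exists_bits_bound D c
  have key : ∀ (k : ℕ) (x : ℝ), (Real.logb 2)^[k] x ≤ 1 → ∀ L : ℕ, (L : ℝ) ≤ A * max x 1 →
      ∃ i ≤ k, (bitsStep D)^[i] L ≤ A := by
    intro k
    induction k with
    | zero =>
      intro x hx L hL
      refine ⟨0, le_rfl, ?_⟩
      rw [max_eq_right (by simpa using hx), mul_one] at hL
      exact_mod_cast hL
    | succ k ih =>
      intro x hx L hL
      -- Once `x ≤ 1` the bound `A` is reached; the iteration must stop here, since
      -- `exists_bits_bound` needs `1 ≤ x`.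
      rcases le_or_gt x 1 with h1 | h1
      · rw [max_eq_right h1, mul_one] at hL
        exact ⟨0, Nat.zero_le _, by exact_mod_cast hL⟩
      · rw [max_eq_left h1.le] at hL
        obtain ⟨i, hi, hiA⟩ := ih (Real.logb 2 x) (by simpa using hx) (bitsStep D L)
          (hA L x h1.le hL)
        exact ⟨i + 1, by omega, by simpa using hiA⟩
  refine ⟨A, fun n => key _ n (logStar_spec n) _ ?_⟩
  have hsize : n.size ≤ n := Nat.size_le.2 Nat.lt_two_pow_self
  have h1 : c * n.size + 1 ≤ A * max n 1 :=
    calc c * n.size + 1 ≤ c * max n 1 + 1 * max n 1 :=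
          add_le_add (Nat.mul_le_mul_left c (hsize.trans (le_max_left n 1)))
            ((le_max_right n 1).trans (one_mul _).ge)
      _ = (c + 1) * max n 1 := by ring
      _ ≤ A * max n 1 := Nat.mul_le_mul_right _ hcA
  exact_mod_cast h1

theorem one_le_logStar {n : ℕ} (hn : 2 ≤ n) : 1 ≤ logStar n := by
  by_contra! h
  have h1 := logStar_spec n
  rw [Nat.lt_one_iff.1 h, Function.iterate_zero, id] at h1
  have h2 : n ≤ 1 := by exact_mod_cast h1
  omega

/-! ### Local colorings and local nets -/

section Coloring

variable {In : Type} {Δ c n : ℕ}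

/-- The colors are less than `m`, and nodes within distance `d` have distinct colors. -/
def IsDistColoring (d m : ℕ) (F : Labeling.{u} In Δ c n ℕ) : Prop :=
  ∀ N v, F N v < m ∧ ∀ w, v ≠ w → N.G.dist v w ≤ d → F N v ≠ F N w

theorem IsDistColoring.exists_recolor {d L t : ℕ} {F : Labeling.{u} In Δ c n ℕ}
    (hF : IsLocal t F) (hc : IsDistColoring d (2 ^ L) F) :
    ∃ F' : Labeling.{u} In Δ c n ℕ, IsLocal (t + d) F' ∧
      IsDistColoring d (2 ^ bitsStep ((Δ + 1) ^ d) L) F' := by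
  obtain ⟨g, hg⟩ := exists_recoloring ((Δ + 1) ^ d) L
  have hball : ∀ N v, ballLabels F d N v ⊆ Set.Iio (2 ^ L) := by
    rintro N v _ ⟨w, -, rfl⟩
    exact (hc N w).1
  refine ⟨fun N v => g (F N v) (ballLabels F d N v),
    (hF.map₂ (hF.ballLabels d) g).mono (by omega), fun N v => ?_⟩
  obtain ⟨h1, h2⟩ := hg (F N v) _ (hc N v).1 (hball N v) (ncard_ballLabels_le F d N v)
  refine ⟨h1, fun w hvw hd => ?_⟩
  exact h2 (F N w) _ (hc N w).1 (hball N w) (ncard_ballLabels_le F d N w)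
    ((hc N v).2 w hvw hd) ⟨w, hd, rfl⟩

theorem IsDistColoring.exists_iterate {d L t : ℕ} {F : Labeling.{u} In Δ c n ℕ}
    (hF : IsLocal t F) (hc : IsDistColoring d (2 ^ L) F) (i : ℕ) :
    ∃ F' : Labeling.{u} In Δ c n ℕ, IsLocal (t + i * d) F' ∧
      IsDistColoring d (2 ^ (bitsStep ((Δ + 1) ^ d))^[i] L) F' := by
  induction i with
  | zero => exact ⟨F, by simpa using hF, hc⟩
  | succ i ih =>
    obtain ⟨F', hF', hc'⟩ := ih
    obtain ⟨F'', hF'', hc''⟩ := hc'.exists_recolor hF'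
    rw [← Function.iterate_succ_apply' (bitsStep _)] at hc''
    exact ⟨F'', by rwa [add_mul, one_mul, ← add_assoc], hc''⟩

theorem isDistColoring_ident (d : ℕ) :
    IsDistColoring d (2 ^ (c * n.size + 1)) (fun N v => N.ident v : Labeling.{u} In Δ c n ℕ) := by
  refine fun N v => ⟨?_, fun w hvw _ h => hvw (N.ident_injective h)⟩
  calc N.ident v ≤ n ^ c := N.ident_le v
    _ ≤ (2 ^ n.size) ^ c := Nat.pow_le_pow_left (Nat.lt_size_self n).le c
    _ = 2 ^ (c * n.size) := by rw [← pow_mul, mul_comm]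
    _ < 2 ^ (c * n.size + 1) := Nat.pow_lt_pow_right (by norm_num) (Nat.lt_succ_self _)

/-- Distance-`d` colorings with a bounded number of colors can be found in `O(log* n)` rounds. -/
theorem exists_isDistColoring (In : Type) (Δ c d : ℕ) :
    ∃ m : ℕ, ∀ n, ∃ F : Labeling.{u} In Δ c n ℕ, IsLocal (d * logStar n) F ∧
      IsDistColoring d m F := by
  obtain ⟨A, hA⟩ := exists_iterate_bitsStep_le ((Δ + 1) ^ d) c
  refine ⟨2 ^ A, fun n => ?_⟩
  obtain ⟨i, hi, hiA⟩ := hA n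
  obtain ⟨F, hF, hc⟩ := (isDistColoring_ident (In := In) (Δ := Δ) (c := c) (n := n) d).exists_iterate
    isLocal_ident i
  refine ⟨F, hF.mono ?_, fun N v => ⟨(hc N v).1.trans_le ?_, (hc N v).2⟩⟩
  · rw [zero_add, mul_comm]
    exact Nat.mul_le_mul_left d hi
  · exact Nat.pow_le_pow_right (by norm_num) hiA

/-- The greedy net of `C` for distance `d`, after the nodes of the first `k` colors have decided. -/
def greedyNet (col : Labeling.{u} In Δ c n ℕ) (C : Labeling.{u} In Δ c n Prop) (d : ℕ) :
    ℕ → Labeling.{u} In Δ c n Prop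
  | 0 => fun _ _ => False
  | k + 1 => fun N v => greedyNet col C d k N v ∨
      (C N v ∧ col N v = k) ∧ True ∉ ballLabels (greedyNet col C d k) d N v

theorem true_mem_ballLabels {F : Labeling.{u} In Δ c n Prop} {d : ℕ} {N : Network.{u} In Δ c n}
    {v : N.V} : True ∈ ballLabels F d N v ↔ ∃ w, F N w ∧ N.G.dist v w ≤ d := by
  simp [ballLabels, and_comm]

theorem IsLocal.greedyNet {t d : ℕ} {col : Labeling.{u} In Δ c n ℕ}
    {C : Labeling.{u} In Δ c n Prop} (hcol : IsLocal t col) (hC : IsLocal t C) (k : ℕ) :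
    IsLocal (t + k * d) (greedyNet col C d k) := by
  induction k with
  | zero => exact (IsLocal.const False).mono (Nat.zero_le _)
  | succ k ih =>
    have h1 := hC.map₂ hcol fun p i => p ∧ i = k
    have h2 := h1.map₂ (ih.ballLabels d) fun p s => p ∧ True ∉ s
    refine (ih.map₂ h2 fun p q => p ∨ q).mono ?_
    rw [add_mul]
    omega

theorem greedyNet_mono {col : Labeling.{u} In Δ c n ℕ} {C : Labeling.{u} In Δ c n Prop} {d : ℕ}
    {N : Network.{u} In Δ c n} {v : N.V} {k l : ℕ} (h : k ≤ l) (hv : greedyNet col C d k N v) :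
    greedyNet col C d l N v := by
  induction h with
  | refl => exact hv
  | step _ ih => exact Or.inl ih

/-- Nodes that decide simultaneously share a colour, hence are more than `d ≥ e` apart and cannot
conflict. A candidate rejected at its turn has a selected node within `e`. -/
theorem isNet_greedyNet {d e m : ℕ} {col : Labeling.{u} In Δ c n ℕ}
    (hcol : IsDistColoring d m col) (C : Labeling.{u} In Δ c n Prop) (he : e ≤ d)
    (N : Network.{u} In Δ c n) :
    N.G.IsNet e {v | C N v} {v | greedyNet col C e m N v} := by
  have hsub : ∀ k v, greedyNet col C e k N v → C N v := by
    intro k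
    induction k with
    | zero => exact fun _ h => h.elim
    | succ k ih => exact fun v h => h.elim (ih v) fun h => h.1.1
  have hsep : ∀ k v w, greedyNet col C e k N v → greedyNet col C e k N w → v ≠ w →
      e < N.G.dist v w := by
    intro k
    induction k with
    | zero => exact fun _ _ h => h.elim
    | succ k ih =>
      have hnew : ∀ v w, greedyNet col C e k N v →
          True ∉ ballLabels (greedyNet col C e k) e N w → e < N.G.dist v w := by
        intro v w hv hw
        by_contra! hd
        rw [SimpleGraph.dist_comm] at hd
        exact hw (true_mem_ballLabels.2 ⟨v, hv, hd⟩)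
      rintro v w (hv | ⟨⟨-, hv⟩, hv'⟩) (hw | ⟨⟨-, hw⟩, hw'⟩) hvw
      · exact ih v w hv hw hvw
      · exact hnew v w hv hw'
      · exact (hnew w v hw hv').trans_eq SimpleGraph.dist_comm
      · by_contra! hd
        exact (hcol N v).2 w hvw (hd.trans he) (hv.trans hw.symm)
  refine ⟨hsub m, fun v hv w hw => hsep m v w hv hw, fun v hv => ?_⟩
  have hm : col N v + 1 ≤ m := (hcol N v).1
  by_cases h : True ∈ ballLabels (greedyNet col C e (col N v)) e N v
  · obtain ⟨w, hw, hvw⟩ := true_mem_ballLabels.1 h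
    exact ⟨w, greedyNet_mono (Nat.le_of_succ_le hm) hw, hvw⟩
  · exact ⟨v, greedyNet_mono hm (Or.inr ⟨⟨hv, rfl⟩, h⟩), by simp⟩

end Coloring

/-! ### The permanent nodes are computed locally -/

section Growth

variable {In : Type} {Δ c n : ℕ}

/-- Whether a node is a core, expressed through the identifiers that the node sees. -/
def coreLabels : Labeling.{u} In Δ c n Prop := fun N v =>
  ∀ L ∈ ballLabels (ballLabels (fun N v => N.ident v) 2) 2 N v,
    L ⊆ ballLabels (fun N v => N.ident v) 2 N v → L = ballLabels (fun N v => N.ident v) 2 N v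

theorem isLocal_coreLabels : IsLocal 4 (coreLabels : Labeling.{u} In Δ c n Prop) := by
  have h : IsLocal 2 (ballLabels (fun N v => N.ident v) 2 : Labeling.{u} In Δ c n (Set ℕ)) :=
    isLocal_ident.ballLabels 2
  exact (h.ballLabels 2).map₂ h fun S T => ∀ L ∈ S, L ⊆ T → L = T

/-- As identifiers are distinct, inclusion and equality of balls can be tested on their sets of
identifiers. -/
theorem setOf_coreLabels (N : Network.{u} In Δ c n) : {v | coreLabels N v} = N.G.cores := by
  ext v
  simp only [coreLabels, ballLabels, SimpleGraph.cores, Set.mem_ofPred_eq, Set.forall_mem_image,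
    Set.image_subset_image_iff N.ident_injective, Set.image_eq_image N.ident_injective]

/-- The nodes at distance exactly `2` from `F`. -/
def distTwoLabels (F : Labeling.{u} In Δ c n Prop) : Labeling.{u} In Δ c n Prop := fun N v =>
  True ∈ ballLabels F 2 N v ∧ True ∉ ballLabels F 1 N v

/-- Membership in the growing sets of permanent nodes. -/
def growthLabels (col : Labeling.{u} In Δ c n ℕ) (m : ℕ) : ℕ → Labeling.{u} In Δ c n Prop
  | 0 => fun _ _ => False
  | 1 => greedyNet col coreLabels 6 m
  | i + 2 => fun N v => growthLabels col m (i + 1) N v ∨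
      greedyNet col (distTwoLabels (growthLabels col m (i + 1))) 1 m N v

theorem isGrowth_growthLabels {col : Labeling.{u} In Δ c n ℕ} {m : ℕ}
    (hcol : IsDistColoring 6 m col) (N : Network.{u} In Δ c n) :
    N.G.IsGrowth fun i => {v | growthLabels col m i N v} := by
  refine ⟨rfl, ?_, ?_⟩
  · rw [← setOf_coreLabels]
    exact isNet_greedyNet hcol coreLabels le_rfl N
  · rintro (_ | i) hi
    · omega
    refine ⟨{v | greedyNet col (distTwoLabels (growthLabels col m (i + 1))) 1 m N v}, rfl, ?_⟩
    have hset : {v | distTwoLabels (growthLabels col m (i + 1)) N v} =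
        {v | (∃ u ∈ {u | growthLabels col m (i + 1) N u}, N.G.dist v u ≤ 2) ∧
          ∀ u ∈ {u | growthLabels col m (i + 1) N u}, ¬ N.G.dist v u ≤ 1} := by
      ext v
      simp [distTwoLabels, true_mem_ballLabels]
    exact hset ▸ isNet_greedyNet hcol _ (by norm_num) N

theorem IsLocal.growthLabels {t : ℕ} {col : Labeling.{u} In Δ c n ℕ} (hcol : IsLocal t col)
    (m i : ℕ) : IsLocal (t + i * (6 * m + 4)) (growthLabels col m i) := by
  induction i using Nat.twoStepInduction with
  | zero => exact (IsLocal.const False).mono (Nat.zero_le _)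
  | one =>
    refine ((hcol.mono (Nat.le_add_right t 4)).greedyNet
      (isLocal_coreLabels.mono (Nat.le_add_left 4 t)) m).mono ?_
    omega
  | more i _ ih =>
    have hT : IsLocal (t + (i + 1) * (6 * m + 4) + 2)
        (distTwoLabels (_root_.growthLabels col m (i + 1))) :=
      ((ih.ballLabels 2).map₂ (ih.ballLabels 1) fun S T => True ∈ S ∧ True ∉ T).mono (by omega)
    refine (ih.map₂ (IsLocal.greedyNet (d := 1) (hcol.mono ?_) hT m) fun p q => p ∨ q).mono ?_
    · rw [add_assoc]
      exact Nat.le_add_right _ _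
    · rw [show (i + 2) * (6 * m + 4) = (i + 1) * (6 * m + 4) + (6 * m + 4) by ring]
      omega

/-- Membership in a set on the way from `F` to the permanent nodes. -/
theorem IsLocal.halfSchedule {t : ℕ} {F : Labeling.{u} In Δ c n Prop}
    {R : ℕ → Labeling.{u} In Δ c n Prop} (hF : IsLocal t F) {K : ℕ} (hR : ∀ i ≤ K, IsLocal t (R i))
    {k : ℕ} (hk : k + 1 ≤ 2 * K) :
    IsLocal (t + 1) (fun N v => v ∈ SimpleGraph.IsGrowth.halfSchedule N.G
      (fun i => {v | R i N v}) {v | F N v} k : Labeling.{u} In Δ c n Prop) := by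
  have h1 := (hR ((k + 1) / 2) (by omega)).neighbors
  have h2 := (hF.map₂ h1 fun p S => p ∧ True ∉ S).map₂ (hR (k / 2) (by omega)) fun p q => p ∨ q
  refine Eq.mp (congrArg _ ?_) (h2.mono (t' := t + 1) (by omega))
  funext N v
  simp [SimpleGraph.IsGrowth.halfSchedule, SimpleGraph.clearing, SimpleGraph.adj_comm, imp_not_comm]

theorem IsLocal.schedule {t : ℕ} {F F' : Labeling.{u} In Δ c n Prop}
    {R : ℕ → Labeling.{u} In Δ c n Prop} (hF : IsLocal t F) (hF' : IsLocal t F')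
    (hR : ∀ i ≤ 6, IsLocal t (R i)) (k : ℕ) :
    IsLocal (t + 1) (fun N v => v ∈ SimpleGraph.IsGrowth.schedule N.G
      (fun i => {v | R i N v}) {v | F N v} {v | F' N v} k : Labeling.{u} In Δ c n Prop) := by
  unfold SimpleGraph.IsGrowth.schedule
  split_ifs
  -- Here `K = 6`: the condition `k + 1 ≤ 2 * K` reads `11 ≤ 12` for `k = 10`, although only the
  -- sets up to `R 5` occur.
  · exact hF.halfSchedule hR (by omega)
  · exact (hR 5 (by norm_num)).mono (Nat.le_succ t)
  · exact hF'.halfSchedule hR (by omega)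

end Growth

/-! ### Assembling the algorithm -/

open Classical in
theorem exists_isLocal_schedule (Δ c : ℕ) : ∃ C : ℕ, ∀ n, 2 ≤ n →
    ∃ (T : ℕ) (f : View (Bool × Bool) T → Fin (28 + 1) → Bool), T ≤ C * logStar n ∧
      ∀ N : Network.{u} (Bool × Bool) Δ c n, 3 < N.G.ediam → ∀ α β : Set N.V,
        Maximal N.G.IsIndepSet α → Maximal N.G.IsIndepSet β →
        N.input = reconfigurationInput α β →
        IsReconfigurationSchedule N.G (fun H U => IsRulingSet H 2 4 U) α β 28
          (outputSets fun v => f (N.view T v)) := by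
  obtain ⟨m, hm⟩ := exists_isDistColoring.{u} (Bool × Bool) Δ c 6
  refine ⟨6 + (6 * (6 * m + 4) + 1), fun n hn => ?_⟩
  obtain ⟨col, hcol, hc⟩ := hm n
  set s := 6 * (6 * m + 4)
  have hF : IsLocal (6 * logStar n + s)
      (fun N v => (N.input v).1 = true : Labeling.{u} (Bool × Bool) Δ c n Prop) :=
    (isLocal_input.map fun x : Bool × Bool => x.1 = true).mono (Nat.zero_le _)
  have hF' : IsLocal (6 * logStar n + s)
      (fun N v => (N.input v).2 = true : Labeling.{u} (Bool × Bool) Δ c n Prop) :=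
    (isLocal_input.map fun x : Bool × Bool => x.2 = true).mono (Nat.zero_le _)
  have hR : ∀ i ≤ 6, IsLocal (6 * logStar n + s) (growthLabels col m i) := fun i hi =>
    (hcol.growthLabels m i).mono (add_le_add le_rfl (Nat.mul_le_mul_right _ hi))
  obtain ⟨f, hf⟩ := IsLocal.pi fun i : Fin (28 + 1) =>
    (hF.schedule hF' hR i).map fun p => decide p
  refine ⟨_, f, ?_, fun N hdiam α β hα hβ hin => ?_⟩
  · have h1 := Nat.mul_le_mul_left (s + 1) (one_le_logStar hn)
    rw [add_mul]
    omega
  · have hα' : {v | (N.input v).1 = true} = α := by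
      ext v
      simp [hin, reconfigurationInput]
    have hβ' : {v | (N.input v).2 = true} = β := by
      ext v
      simp [hin, reconfigurationInput]
    convert (isGrowth_growthLabels hc N).isReconfigurationSchedule N.connected hdiam hα hβ using 1
    funext i
    ext v
    rw [outputSets, Set.mem_ofPred_eq, ← hf N v, ← hα', ← hβ']
    exact decide_eq_true_iff

theorem mainTheorem6 (Δ c : ℕ) :
    ∃ (C : ℕ) (A : LocalAlgorithm (Bool × Bool) (Fin (28 + 1) → Bool)),
      (∀ n : ℕ, A.rounds n ≤ C * logStar n) ∧
      ∀ (V : Type*) [Fintype V] (G : SimpleGraph V) [DecidableRel G.Adj],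
        G.Connected → 3 < G.ediam → (∀ v : V, G.degree v ≤ Δ) →
        ∀ α β : Set V, Maximal G.IsIndepSet α → Maximal G.IsIndepSet β →
        ∀ ident : V → ℕ, Function.Injective ident → (∀ v : V, ident v ≤ Fintype.card V ^ c) →
          IsReconfigurationSchedule G (fun H U => IsRulingSet H 2 4 U) α β 28
            (outputSets (A.run G ident (reconfigurationInput α β))) := by
  obtain ⟨C, hC⟩ := exists_isLocal_schedule Δ c
  have hC' : ∀ n, ∃ (T : ℕ) (f : View (Bool × Bool) T → Fin (28 + 1) → Bool),
      T ≤ C * logStar n ∧ (2 ≤ n → ∀ N : Network (Bool × Bool) Δ c n, 3 < N.G.ediam →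
        ∀ α β : Set N.V, Maximal N.G.IsIndepSet α → Maximal N.G.IsIndepSet β →
        N.input = reconfigurationInput α β →
        IsReconfigurationSchedule N.G (fun H U => IsRulingSet H 2 4 U) α β 28
          (outputSets fun v => f (N.view T v))) := by
    intro n
    by_cases hn : 2 ≤ n
    · obtain ⟨T, f, hT, hf⟩ := hC n hn
      exact ⟨T, f, hT, fun _ => hf⟩
    -- For `n ≤ 1` a dummy algorithm with no rounds suffices, since a graph of diameter greater than
    -- 3 has at least two nodes.
    · exact ⟨0, fun _ _ => false, Nat.zero_le _, fun h => absurd h hn⟩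
  choose T f hT hf using hC'
  refine ⟨C, gatherAlgorithm T f fun _ => false, hT, ?_⟩
  intro V _ G _ hG hdiam hdeg α β hα hβ ident hinj hle
  have hnt : Nontrivial V := SimpleGraph.nontrivial_of_ediam_ne_zero (G := G)
    (ne_of_gt (lt_of_le_of_lt bot_le hdiam))
  let N : Network (Bool × Bool) Δ c (Fintype.card V) :=
    { V := V, G := G, ident := ident, input := reconfigurationInput α β, card_eq := rfl,
      connected := hG, degree_le := hdeg, ident_injective := hinj, ident_le := hle }
  have hrun : (gatherAlgorithm T f fun _ => false).run G ident (reconfigurationInput α β) =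
      fun v => f (Fintype.card V) (N.view (T (Fintype.card V)) v) :=
    funext fun v => run_gatherAlgorithm T f (fun _ => false) N v
  rw [hrun]
  exact hf _ Fintype.one_lt_card N hdiam α β hα hβ rfl
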